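/- Let $K$ be a (smooth) knot in $S^3$ and let $\Delta_K(q)\in\mathbb{Z}[q,q^{-1}]$ be its Alexander polynomial, normalized so that $\Delta_K(q)=\Delta_K(q^{-1})$ and the coefficient of the lowest order term is positive. Let $\deg\Delta_K$ be the largest exponent of $q$ in $\Delta_K(q)$ and write the positive form as $$\Delta^1_K(q):=q^{\deg\Delta_K}\Delta_K(q)=\sum_{i=1}^N a_iq^{n_i},\qquad a_i\in\mathbb{Z}\setminus\{0\},\ n_i \text{ distinct}.$$ For $r\ge 1$ let $$\overline{\Delta}_K(r):=q^{r\deg\Delta_K}\,\Delta_K(q^r)\,\frac{q-1}{q^r-1}\in\mathbb{Z}((q)),\qquad \frac{q-1}{q^r-1}:=(1-q)\sum_{i\ge 0}q^{ir},$$ be the unreduced $S^r$-colored Alexander polynomial of $K$. Let $\mathcal{A}:=\mathbb{Z}[q,q^{-1}]\langle L,M\rangle/\langle qLM-ML\rangle$ be the Weyl algebra, acting on sequences $f:\{1,2,3,\dots\}\to\mathbb{Z}((q))$ by $(Lf)(r)=f(r+1)$ and $(Mf)(r)=q^rf(r)$; in accordance with the relation $qLM=ML$, a product $AB\in\mathcal{A}$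 acts by first applying $A$ and then $B$ (so sequences form a right $\mathcal{A}$-module). For $X\in\mathbb{Z}[q,q^{-1}]$ let $D_X:=1-XL\in\mathcal{A}$ (these elements commute), and set $$A_K:=\prod_{i=1}^N D_{q^{-n_i}},\qquad \overline{A}_K:=(M-1)A_K\in\mathcal{A}.$$ Then $\overline{A}_K$ is nonzero and annihilates the sequence $\overline{\Delta}_K$. Explicitly, for all $r\ge 1$, $$\sum_{S\subseteq\{n_1,\dots,n_N\}}(-1)^{|S|}\,q^{-\sum_{n\in S}n}\,\bigl(q^{r+|S|}-1\bigr)\,\overline{\Delta}_K(r+|S|)=0.$$ In particular $\overline{\Delta}_K$ is $q$-holonomic: there are $m\ge 0$ and polynomials $b_0,\dots,b_m\in\mathbb{Z}[q,q^{-1}][u]$ with $b_m\neq 0$ such that $\sum_{i=0}^m b_i(q^r)\,\overline{\Delta}_K(r+i)=0$ for all $r\ge 1$. -/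

import Mathlib

noncomputable section

open LaurentPolynomial
open scoped Manifold ContDiff

namespace ColoredAlexander

/-! ### Knots and the Alexander polynomial -/

/-- The 3-sphere, as the unit sphere of Euclidean 4-space. -/
abbrev S3 : Type := Metric.sphere (0 : EuclideanSpace ℝ (Fin (3 + 1))) 1

/-- A knot in `S³`: a smooth embedding of the circle. -/
structure Knot where
  toFun : Circle → S3
  isSmoothEmbedding : Manifold.IsSmoothEmbedding (𝓡 1) (𝓡 3) ∞ toFun

/-- The complement of a knot. -/
abbrev Knot.Complement (K : Knot) : Type := {x : S3 // x ∉ Set.range K.toFun}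

/-- The (zeroth) Fitting ideal of a finitely generated module: it is generated by the maximal
minors of the presentation matrices, i.e. by the determinants of all square matrices of relations
among finite systems of generators. -/
def fittingIdeal (R M : Type*) [CommRing R] [AddCommGroup M] [Module R M] : Ideal R :=
  Ideal.span {d | ∃ (n : ℕ) (g : Fin n → M) (A : Matrix (Fin n) (Fin n) R),
    Submodule.span R (Set.range g) = ⊤ ∧ (∀ i, ∑ j, A i j • g j = 0) ∧ d = A.det}

/-- The Alexander module `G'/G''` of a group `G`. When `G` is a knot group this is the first
homology group of the infinite cyclic cover of the knot complement. The element `s` is the one by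
which `T` acts, see below. -/
def AlexanderModule (G : Type*) [Group G] (_s : G) : Type _ :=
  Additive (Abelianization (commutator G))

instance (G : Type*) [Group G] (s : G) : AddCommGroup (AlexanderModule G s) :=
  inferInstanceAs (AddCommGroup (Additive (Abelianization (commutator G))))

/-- The automorphism of `G'/G''` induced by the conjugation `x ↦ s x s⁻¹`. -/
def conjAut (G : Type*) [Group G] (s : G) : (Module.End ℤ (AlexanderModule G s))ˣ :=
  (LinearMap.GeneralLinearGroup.generalLinearEquiv ℤ (AlexanderModule G s)).symm
    (AddEquiv.toIntLinearEquiv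
      (MulEquiv.toAdditive (MulEquiv.abelianizationCongr (MulAut.conjNormal s))))

/-- `ℤ[T;T⁻¹]` acts on `G'/G''`, with `T` acting through conjugation by `s`. -/
def alexanderAction (G : Type*) [Group G] (s : G) :
    ℤ[T;T⁻¹] →ₐ[ℤ] Module.End ℤ (AlexanderModule G s) :=
  AddMonoidAlgebra.lift ℤ (Module.End ℤ (AlexanderModule G s)) ℤ
    ((Units.coeHom _).comp (zpowersHom _ (conjAut G s)))

instance (G : Type*) [Group G] (s : G) : Module ℤ[T;T⁻¹] (AlexanderModule G s) :=
  Module.compHom (AlexanderModule G s) (alexanderAction G s).toRingHom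

/-- `Δ` is the Alexander polynomial of the knot `K` in its symmetrized form: it generates the
smallest principal ideal containing the Fitting ideal of the Alexander module of the knot group,
it satisfies `Δ(q) = Δ(q⁻¹)`, and its term of lowest order has a positive coefficient.
Here `T` acts on the Alexander module through any `s` whose class generates the (infinite cyclic)
abelianization of the knot group. -/
def IsAlexanderPolynomial (K : Knot) (Δ : ℤ[T;T⁻¹]) : Prop :=
  (∃ (x : K.Complement) (s : FundamentalGroup K.Complement x),
    (∀ y : Abelianization (FundamentalGroup K.Complement x),
      y ∈ Subgroup.zpowers (Abelianization.of s)) ∧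
    fittingIdeal ℤ[T;T⁻¹] (AlexanderModule _ s) ≤ Ideal.span {Δ} ∧
    ∀ P : ℤ[T;T⁻¹], fittingIdeal ℤ[T;T⁻¹] (AlexanderModule _ s) ≤ Ideal.span {P} →
      Ideal.span {Δ} ≤ Ideal.span {P}) ∧
  LaurentPolynomial.invert Δ = Δ ∧
  ∃ m : ℤ, (∀ n < m, Δ.coeff n = 0) ∧ 0 < Δ.coeff m

/-- The largest exponent of `q` occurring in a (nonzero) Laurent polynomial. -/
def deg (Δ : ℤ[T;T⁻¹]) : ℤ := Δ.degree.unbotD 0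

/-- The positive form `Δ¹(q) = q^{deg Δ} Δ(q)`. -/
def positiveForm (Δ : ℤ[T;T⁻¹]) : ℤ[T;T⁻¹] := T (deg Δ) * Δ

/-! ### Sequences of colored Alexander polynomials -/

/-- `q`, as a unit of the ring `ℤ((q))`. -/
def qUnit : (LaurentSeries ℤ)ˣ where
  val := HahnSeries.single 1 1
  inv := HahnSeries.single (-1) 1
  val_inv := by simp
  inv_val := by simp

/-- `ℤ((q))`, the ring of power series in `q` which are bounded in negative powers of `q`, is an
algebra over the Laurent polynomials in `q`. -/
instance : Algebra ℤ[T;T⁻¹] (LaurentSeries ℤ) :=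
  (LaurentPolynomial.eval₂ (Int.castRingHom (LaurentSeries ℤ)) qUnit).toAlgebra

/-- Sequences `r ↦ f(r)` of elements of `ℤ((q))`, indexed by the colors `r = 1, 2, 3, …`. -/
abbrev QSeq : Type := ℕ+ → LaurentSeries ℤ

/-- The color `r + k`, for `r ≥ 1` and `k ≥ 0`. -/
def addNat (r : ℕ+) (k : ℕ) : ℕ+ := ⟨r + k, Nat.add_pos_left r.pos k⟩

/-- The rational function `(q-1)/(q^r-1)`, as the power series `(1-q) ∑_{i ≥ 0} q^{ir}`. -/
def unknotSeries (r : ℕ+) : PowerSeries ℤ :=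
  (1 - PowerSeries.X) * PowerSeries.mk fun n => if (r : ℕ) ∣ n then 1 else 0

/-- The unreduced `S^r`-colored Alexander polynomials
`r ↦ q^{r deg Δ} Δ(q^r) (q-1)/(q^r-1)`. -/
def coloredAlexander (Δ : ℤ[T;T⁻¹]) : QSeq := fun r =>
  HahnSeries.single ((r : ℤ) * deg Δ) 1 *
    (∑ n ∈ Δ.coeff.support, HahnSeries.single ((r : ℤ) * n) (Δ.coeff n)) *
    (unknotSeries r : LaurentSeries ℤ)

/-! ### The Weyl algebra and its action on sequences -/

/-- The two generators of the Weyl algebra. -/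
inductive WeylGen
  | L
  | M

/-- The relation `q L M = M L`. -/
inductive WeylRel : FreeAlgebra ℤ[T;T⁻¹] WeylGen → FreeAlgebra ℤ[T;T⁻¹] WeylGen → Prop
  | rel : WeylRel
      ((T 1 : ℤ[T;T⁻¹]) •
        (FreeAlgebra.ι ℤ[T;T⁻¹] WeylGen.L * FreeAlgebra.ι ℤ[T;T⁻¹] WeylGen.M))
      (FreeAlgebra.ι ℤ[T;T⁻¹] WeylGen.M * FreeAlgebra.ι ℤ[T;T⁻¹] WeylGen.L)

/-- The Weyl algebra `ℤ[q,q⁻¹]⟨L, M⟩ / (q L M - M L)`. -/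
def Weyl : Type := RingQuot WeylRel

instance : Ring Weyl := inferInstanceAs (Ring (RingQuot WeylRel))

instance : Algebra ℤ[T;T⁻¹] Weyl := inferInstanceAs (Algebra ℤ[T;T⁻¹] (RingQuot WeylRel))

/-- The quotient map from the free algebra to the Weyl algebra. -/
def Weyl.mk : FreeAlgebra ℤ[T;T⁻¹] WeylGen →ₐ[ℤ[T;T⁻¹]] Weyl :=
  RingQuot.mkAlgHom ℤ[T;T⁻¹] WeylRel

/-- The generator `L` of the Weyl algebra. -/
def wL : Weyl := Weyl.mk (FreeAlgebra.ι _ WeylGen.L)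

/-- The generator `M` of the Weyl algebra. -/
def wM : Weyl := Weyl.mk (FreeAlgebra.ι _ WeylGen.M)

/-- The shift operator `(L f)(r) = f(r+1)`. -/
def opL : Module.End ℤ[T;T⁻¹] QSeq where
  toFun f := fun r => f (r + 1)
  map_add' _ _ := rfl
  map_smul' _ _ := rfl

/-- The multiplication operator `(M f)(r) = q^r f(r)`. -/
def opM : Module.End ℤ[T;T⁻¹] QSeq where
  toFun f := fun r => (T (r : ℤ) : ℤ[T;T⁻¹]) • f r
  map_add' f g := by ext1 r; simp
  map_smul' c f := by ext1 r; simp [smul_comm c]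

/-- The operators assigned to the generators. -/
def opGen : WeylGen → (Module.End ℤ[T;T⁻¹] QSeq)ᵐᵒᵖ
  | WeylGen.L => MulOpposite.op opL
  | WeylGen.M => MulOpposite.op opM

theorem opGen_rel ⦃x y : FreeAlgebra ℤ[T;T⁻¹] WeylGen⦄ (h : WeylRel x y) :
    FreeAlgebra.lift ℤ[T;T⁻¹] opGen x = FreeAlgebra.lift ℤ[T;T⁻¹] opGen y := by
  cases h
  simp only [map_smul, map_mul, FreeAlgebra.lift_ι_apply, opGen]
  apply MulOpposite.unop_injective
  ext1 f
  funext r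
  change (T 1 : ℤ[T;T⁻¹]) • ((T (r : ℤ) : ℤ[T;T⁻¹]) • f (r + 1)) =
    (T ((r + 1 : ℕ+) : ℤ) : ℤ[T;T⁻¹]) • f (r + 1)
  rw [smul_smul, ← T_add, add_comm (1 : ℤ)]
  simp

/-- The action of the Weyl algebra on sequences. The relation `q L M = M L` is satisfied by the
operators `(L f)(r) = f(r+1)` and `(M f)(r) = q^r f(r)` exactly when products are read from left to
right (first apply the left factor), so sequences form a right module. -/
def weylAction : Weyl →ₐ[ℤ[T;T⁻¹]] (Module.End ℤ[T;T⁻¹] QSeq)ᵐᵒᵖ :=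
  RingQuot.liftAlgHom ℤ[T;T⁻¹] ⟨FreeAlgebra.lift ℤ[T;T⁻¹] opGen, opGen_rel⟩

theorem weylAction_mk (x : FreeAlgebra ℤ[T;T⁻¹] WeylGen) :
    weylAction (Weyl.mk x) = FreeAlgebra.lift ℤ[T;T⁻¹] opGen x :=
  RingQuot.liftAlgHom_mkAlgHom_apply ℤ[T;T⁻¹] _ opGen_rel x

/-- The sequence obtained by letting `A` act on `f`. -/
def act (f : QSeq) (A : Weyl) : QSeq := (weylAction A).unop f

theorem act_wL (f : QSeq) (r : ℕ+) : act f wL r = f (r + 1) := by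
  simp [act, weylAction_mk, wL, opGen, opL]

theorem act_wM (f : QSeq) (r : ℕ+) : act f wM r = (T (r : ℤ) : ℤ[T;T⁻¹]) • f r := by
  simp [act, weylAction_mk, wM, opGen, opM]

theorem act_mul (f : QSeq) (A B : Weyl) : act f (A * B) = act (act f A) B := by
  simp [act]

/-- The annihilator of a sequence in the Weyl algebra. -/
def Ann (f : QSeq) : Set Weyl := {A | act f A = 0}

/-- The difference operator `D_X = 1 - X L`. -/
def D (X : ℤ[T;T⁻¹]) : Weyl := 1 - X • wL

theorem D_commute (X Y : ℤ[T;T⁻¹]) : Commute (D X) (D Y) := by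
  have h : Commute (X • wL) (Y • wL) :=
    ((Commute.refl wL).smul_left X).smul_right Y
  exact (Commute.one_left _).sub_left ((Commute.one_right _).sub_right h)

/-- `A_K = ∏_i D_{q^{-n_i}}`, where the `n_i` are the exponents occurring in the positive form
of the Alexander polynomial. -/
def reducedOperator (Δ : ℤ[T;T⁻¹]) : Weyl :=
  (positiveForm Δ).coeff.support.noncommProd (fun n => D (T (-n)))
    (fun _ _ _ _ _ => D_commute _ _)

/-- `(M - 1) A_K`. -/
def unreducedOperator (Δ : ℤ[T;T⁻¹]) : Weyl := (wM - 1) * reducedOperator Δ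

/-- A sequence `f` is `q`-holonomic if it satisfies a nontrivial linear recurrence
`∑_{i=0}^{m} a_i(q^n) f(n+i) = 0` for all `n`, where `a_i(u) ∈ ℤ[q,q⁻¹][u]` and `a_m ≠ 0`. -/
def IsQHolonomic (f : QSeq) : Prop :=
  ∃ (m : ℕ) (a : ℕ → Polynomial ℤ[T;T⁻¹]), a m ≠ 0 ∧
    ∀ n : ℕ+, ∑ i ∈ Finset.range (m + 1),
      (a i).eval (T (n : ℤ)) • f (addNat n i) = 0

end ColoredAlexander

end

noncomputable section

open LaurentPolynomial

namespace ColoredAlexander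

/-! ### Scalars acting on Laurent series -/

theorem T_smul (n : ℤ) (x : LaurentSeries ℤ) :
    (T n : ℤ[T;T⁻¹]) • x = HahnSeries.single n 1 * x := by
  have key : ∀ m : ℤ, ((qUnit ^ m : (LaurentSeries ℤ)ˣ) : LaurentSeries ℤ) =
      HahnSeries.single m 1 := by
    intro m
    induction m using Int.induction_on with
    | zero => simp
    | succ i ih =>
      rw [zpow_add_one, Units.val_mul, ih]
      simp [qUnit]
    | pred i ih =>
      rw [zpow_sub_one, Units.val_mul, ih]
      simp [qUnit, sub_eq_add_neg]
  rw [Algebra.smul_def]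
  congr 1
  change LaurentPolynomial.eval₂ (Int.castRingHom (LaurentSeries ℤ)) qUnit (T n) = _
  rw [LaurentPolynomial.eval₂_T]
  exact key n

/-! ### The action of polynomials in the shift operator -/

theorem act_zero_left (A : Weyl) : act 0 A = 0 := by simp [act]

theorem act_sum_left {ι : Type*} (s : Finset ι) (f : ι → QSeq) (A : Weyl) :
    act (∑ i ∈ s, f i) A = ∑ i ∈ s, act (f i) A := by simp [act]

theorem act_smul_left (c : ℤ[T;T⁻¹]) (f : QSeq) (A : Weyl) :
    act (c • f) A = c • act f A := by simp [act]

theorem act_sum_right {ι : Type*} (f : QSeq) (s : Finset ι) (A : ι → Weyl) :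
    act f (∑ i ∈ s, A i) = ∑ i ∈ s, act f (A i) := by simp [act]

theorem act_smul_right (c : ℤ[T;T⁻¹]) (f : QSeq) (A : Weyl) :
    act f (c • A) = c • act f A := by simp [act]

theorem act_wL_pow (f : QSeq) (k : ℕ) (r : ℕ+) : act f (wL ^ k) r = f (addNat r k) := by
  induction k generalizing r with
  | zero =>
    have : addNat r 0 = r := PNat.eq (by simp [addNat])
    simp [act, this]
  | succ k ih =>
    rw [pow_succ, act_mul, act_wL, ih]
    congr 1
    apply PNat.eq
    simp [addNat]
    ring

theorem act_wM_sub_one (f : QSeq) (r : ℕ+) :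
    act f (wM - 1) r = (T (r : ℤ) - 1 : ℤ[T;T⁻¹]) • f r := by
  rw [sub_smul, ← act_wM, one_smul]
  simp [act]

theorem act_D (X : ℤ[T;T⁻¹]) (f : QSeq) (r : ℕ+) : act f (D X) r = f r - X • f (r + 1) := by
  rw [← act_wL f]
  simp [act, D]

theorem act_aeval_wL (P : Polynomial ℤ[T;T⁻¹]) (f : QSeq) (r : ℕ+) :
    act f (Polynomial.aeval wL P) r = P.sum fun k c => c • f (addNat r k) := by
  simp only [Polynomial.aeval_eq_sum_range, Polynomial.sum_over_range, zero_smul, implies_true,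
    ← act_wL_pow f]
  simp [act]

/-! ### The annihilating operator -/

/-- The polynomial `∏_n (1 - q^{-n} X)` in the shift operator. -/
def shiftPolynomial (s : Finset ℤ) : Polynomial ℤ[T;T⁻¹] :=
  ∏ n ∈ s, (1 - Polynomial.C (T (-n)) * Polynomial.X)

theorem aeval_wL_one_sub (X : ℤ[T;T⁻¹]) :
    Polynomial.aeval wL (1 - Polynomial.C X * Polynomial.X) = D X := by
  simp [D, Algebra.smul_def]

theorem reducedOperator_eq_aeval (Δ : ℤ[T;T⁻¹]) :
    reducedOperator Δ = Polynomial.aeval wL (shiftPolynomial (positiveForm Δ).coeff.support) := by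
  refine Eq.trans (Finset.noncommProd_congr rfl
    (fun n _ => (aeval_wL_one_sub (T (-n))).symm) _) ?_
  refine (Finset.map_noncommProd _ _ (fun _ _ _ _ _ => Commute.all _ _)
    (Polynomial.aeval (R := ℤ[T;T⁻¹]) wL)).symm.trans ?_
  exact congrArg _ (Finset.noncommProd_eq_prod _ _)

theorem shiftPolynomial_eq_sum (s : Finset ℤ) :
    shiftPolynomial s = ∑ S ∈ s.powerset,
      Polynomial.monomial S.card ((-1) ^ S.card * T (-∑ n ∈ S, n) : ℤ[T;T⁻¹]) := by
  rw [shiftPolynomial, Finset.prod_sub]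
  have hT : ∀ S : Finset ℤ, ∏ n ∈ S, (T (-n) : ℤ[T;T⁻¹]) = T (-∑ n ∈ S, n) := by
    intro S
    induction S using Finset.induction_on with
    | empty => simp
    | insert a S ha ih => rw [Finset.prod_insert ha, Finset.sum_insert ha, ih, ← T_add, neg_add]
  refine Finset.sum_congr rfl fun S _ => ?_
  rw [Finset.prod_const_one, mul_one, Finset.prod_mul_distrib, Finset.prod_const, ← map_prod, hT,
    ← Polynomial.C_mul_X_pow_eq_monomial]
  simp [mul_assoc]

theorem shiftPolynomial_ne_zero (s : Finset ℤ) : shiftPolynomial s ≠ 0 := by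
  intro h
  have := congrArg (Polynomial.eval 0) h
  simp [shiftPolynomial, Polynomial.eval_prod] at this

theorem shiftPolynomial_coeff_zero (s : Finset ℤ) : (shiftPolynomial s).coeff 0 = 1 := by
  simp [shiftPolynomial, Polynomial.coeff_zero_eq_eval_zero, Polynomial.eval_prod]

theorem act_unreducedOperator (Δ : ℤ[T;T⁻¹]) (f : QSeq) (r : ℕ+) :
    act f (unreducedOperator Δ) r =
      (shiftPolynomial (positiveForm Δ).coeff.support).sum fun k c =>
        (c * (T ((r : ℤ) + k) - 1)) • f (addNat r k) := by
  rw [unreducedOperator, reducedOperator_eq_aeval, act_mul, act_aeval_wL]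
  simp only [act_wM_sub_one, smul_smul]
  rfl

theorem unreducedOperator_ne_zero (Δ : ℤ[T;T⁻¹]) : unreducedOperator Δ ≠ 0 := by
  intro h
  have h1 := act_unreducedOperator Δ (Pi.single 1 1) 1
  rw [h, Polynomial.sum_over_range _ (by simp), Finset.sum_eq_single 0] at h1
  · rw [shiftPolynomial_coeff_zero, one_mul, sub_smul, T_smul] at h1
    have h2 : addNat 1 0 = 1 := rfl
    have h3 := congrArg (fun x : LaurentSeries ℤ => x.coeff 0) h1
    simp [act, h2] at h3
  · intro k _ hk
    have : addNat 1 k ≠ 1 := fun h => hk (by simpa [addNat] using congrArg PNat.val h)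
    simp [Pi.single_eq_of_ne this]
  · simp

theorem act_aeval_shiftPolynomial_eq_zero {f : QSeq} {s : Finset ℤ} {n : ℤ} (hn : n ∈ s)
    (h : act f (D (T (-n))) = 0) : act f (Polynomial.aeval wL (shiftPolynomial s)) = 0 := by
  rw [shiftPolynomial, ← Finset.mul_prod_erase s _ hn, map_mul, aeval_wL_one_sub, act_mul, h,
    act_zero_left]

/-- The sequence `r ↦ q^{rn}`. -/
def qPowSeq (n : ℤ) : QSeq := fun r => HahnSeries.single ((r : ℤ) * n) 1

theorem act_qPowSeq_D (n : ℤ) : act (qPowSeq n) (D (T (-n))) = 0 := by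
  funext r
  rw [act_D, T_smul]
  simp [qPowSeq, add_mul]

/-! ### The sequence of colored Alexander polynomials -/

theorem one_sub_X_pow_mul_unknotSeries (r : ℕ+) :
    (1 - PowerSeries.X ^ (r : ℕ)) * unknotSeries r = 1 - PowerSeries.X := by
  rw [unknotSeries, mul_left_comm]
  convert mul_one _
  ext n
  rw [sub_mul, one_mul, map_sub, PowerSeries.coeff_X_pow_mul', PowerSeries.coeff_one]
  simp only [PowerSeries.coeff_mk]
  by_cases hn : (r : ℕ) ≤ n
  · have h0 : n ≠ 0 := by have := r.pos; omega
    simp [hn, h0, Nat.dvd_sub_iff_left hn dvd_rfl]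
  · by_cases h0 : n = 0
    · simp [h0]
    · have : ¬ (r : ℕ) ∣ n := fun h => hn (Nat.le_of_dvd (Nat.pos_of_ne_zero h0) h)
      simp [hn, h0, this]

theorem T_sub_one_smul_unknotSeries (r : ℕ+) :
    (T (r : ℤ) - 1 : ℤ[T;T⁻¹]) • (unknotSeries r : LaurentSeries ℤ) =
      (T 1 - 1 : ℤ[T;T⁻¹]) • (1 : LaurentSeries ℤ) := by
  have h := congrArg (HahnSeries.ofPowerSeries ℤ ℤ) (one_sub_X_pow_mul_unknotSeries r)
  rw [map_mul, map_sub, map_sub, map_pow, map_one, HahnSeries.ofPowerSeries_X,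
    HahnSeries.single_pow] at h
  rw [sub_smul, sub_smul, T_smul, T_smul, one_smul, one_smul, mul_one]
  rw [← neg_inj, neg_sub, neg_sub]
  rw [← h, sub_mul, one_mul]
  simp

theorem act_coloredAlexander_wM_sub_one (Δ : ℤ[T;T⁻¹]) :
    act (coloredAlexander Δ) (wM - 1) = (T 1 - 1 : ℤ[T;T⁻¹]) •
      ∑ n ∈ Δ.coeff.support, (C (Δ.coeff n) : ℤ[T;T⁻¹]) • qPowSeq (deg Δ + n) := by
  funext r
  rw [act_wM_sub_one, coloredAlexander, ← mul_smul_comm, T_sub_one_smul_unknotSeries,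
    mul_smul_comm, mul_one]
  simp only [Pi.smul_apply, Finset.sum_apply, Finset.mul_sum]
  congr 1
  refine Finset.sum_congr rfl fun n _ => ?_
  rw [HahnSeries.single_mul_single, one_mul, Algebra.smul_def]
  change _ = LaurentPolynomial.eval₂ (Int.castRingHom (LaurentSeries ℤ)) qUnit (C _) * _
  rw [LaurentPolynomial.eval₂_C, eq_intCast (Int.castRingHom (LaurentSeries ℤ)),
    ← map_intCast (HahnSeries.C (Γ := ℤ) (R := ℤ)), HahnSeries.C_apply, qPowSeq, mul_add,
    HahnSeries.single_mul_single, zero_add, mul_one, Int.cast_id]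

theorem deg_add_mem_support {Δ : ℤ[T;T⁻¹]} {n : ℤ} (hn : n ∈ Δ.coeff.support) :
    deg Δ + n ∈ (positiveForm Δ).coeff.support := by
  rw [Finsupp.mem_support_iff] at hn ⊢
  rwa [positiveForm, T, AddMonoidAlgebra.coeff_single_mul_add, one_mul]

theorem unreducedOperator_mem_Ann (Δ : ℤ[T;T⁻¹]) :
    unreducedOperator Δ ∈ Ann (coloredAlexander Δ) := by
  change act _ _ = 0
  rw [unreducedOperator, act_mul, act_coloredAlexander_wM_sub_one, act_smul_left, act_sum_left,
    Finset.sum_eq_zero, smul_zero]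
  intro n hn
  rw [act_smul_left, reducedOperator_eq_aeval,
    act_aeval_shiftPolynomial_eq_zero (deg_add_mem_support hn) (act_qPowSeq_D _), smul_zero]

theorem sum_powerset_smul_coloredAlexander (Δ : ℤ[T;T⁻¹]) (r : ℕ+) :
    ∑ S ∈ (positiveForm Δ).coeff.support.powerset,
      ((-1) ^ S.card * T (-∑ n ∈ S, n) * (T ((r : ℤ) + S.card) - 1) : ℤ[T;T⁻¹]) •
        coloredAlexander Δ (addNat r S.card) = 0 := by
  have h := congrFun (unreducedOperator_mem_Ann Δ : act _ _ = 0) r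
  rw [unreducedOperator, reducedOperator_eq_aeval, act_mul, shiftPolynomial_eq_sum, map_sum,
    act_sum_right, Finset.sum_apply] at h
  refine Eq.trans (Finset.sum_congr rfl fun S _ => ?_) h
  rw [Polynomial.aeval_monomial, ← Algebra.smul_def, act_smul_right, Pi.smul_apply, act_wL_pow,
    act_wM_sub_one, smul_smul]
  rfl

theorem isQHolonomic_coloredAlexander (Δ : ℤ[T;T⁻¹]) : IsQHolonomic (coloredAlexander Δ) := by
  set P := shiftPolynomial (positiveForm Δ).coeff.support with hP
  refine ⟨P.natDegree, fun i => Polynomial.C (P.coeff i) *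
    (Polynomial.C (T (i : ℤ)) * Polynomial.X - 1), mul_ne_zero ?_ ?_, fun r => ?_⟩
  · simpa using shiftPolynomial_ne_zero _
  · intro h
    simpa using congrArg (Polynomial.eval 0) h
  · have h := congrFun (unreducedOperator_mem_Ann Δ : act _ _ = 0) r
    rw [act_unreducedOperator, ← hP, Polynomial.sum_over_range _ (by simp)] at h
    rw [← Pi.zero_apply (M := fun _ : ℕ+ => LaurentSeries ℤ) r, ← h]
    refine Finset.sum_congr rfl fun i _ => ?_
    rw [add_comm (r : ℤ), T_add]
    simp [-T_mul]

end ColoredAlexander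

end

theorem mainTheorem3 (K : ColoredAlexander.Knot) (Δ : LaurentPolynomial ℤ)
    (hΔ : ColoredAlexander.IsAlexanderPolynomial K Δ) :
    ColoredAlexander.unreducedOperator Δ ∈
        ColoredAlexander.Ann (ColoredAlexander.coloredAlexander Δ) ∧
      ColoredAlexander.unreducedOperator Δ ≠ 0 ∧
      (∀ r : ℕ+, ∑ S ∈ (ColoredAlexander.positiveForm Δ).coeff.support.powerset,
        ((-1) ^ S.card * LaurentPolynomial.T (-∑ n ∈ S, n) *
            (LaurentPolynomial.T ((r : ℤ) + S.card) - 1) : LaurentPolynomial ℤ) •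
          ColoredAlexander.coloredAlexander Δ (ColoredAlexander.addNat r S.card) = 0) ∧
      ColoredAlexander.IsQHolonomic (ColoredAlexander.coloredAlexander Δ) := by
  exact ⟨ColoredAlexander.unreducedOperator_mem_Ann Δ,
    ColoredAlexander.unreducedOperator_ne_zero Δ,
    ColoredAlexander.sum_powerset_smul_coloredAlexander Δ,
    ColoredAlexander.isQHolonomic_coloredAlexander Δ⟩
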